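/- Let $\mathcal H$ be a complex Hilbert space and let $T, C$ be bounded linear operators on $\mathcal H$ such that $T$ is a contraction ($\|T\|\le 1$) and $CT=TC$. Then the operator $$\widetilde T=\begin{pmatrix}T&C\\0&T\end{pmatrix}$$ on the Hilbert space direct sum $\mathcal H\oplus\mathcal H$ has a 3-isometric lifting: there exist a Hilbert space $\mathcal K$ containing $\mathcal H\oplus\mathcal H$ as a closed subspace and a bounded linear operator $S$ on $\mathcal K$ such that $$I-3S^*S+3S^{*2}S^2-S^{*3}S^3=0 \qquad\text{and}\qquad \widetilde T P=P S,$$ where $P$ is the orthogonal projection of $\mathcal K$ onto $\mathcal H\oplus\mathcal H$. -/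

import Mathlib

noncomputable section

/-- The bounded operator `[[A, B], [C, D]]` on the Hilbert space direct sum `H ⊕ H`
(`WithLp 2` gives the product its Hilbert space norm). -/
def blockOperator {H : Type*} [NormedAddCommGroup H] [InnerProductSpace ℂ H]
    (A B C D : H →L[ℂ] H) : WithLp 2 (H × H) →L[ℂ] WithLp 2 (H × H) :=
  (WithLp.prodContinuousLinearEquiv 2 ℂ H H).symm.toContinuousLinearMap ∘L
    ((A ∘L WithLp.fstL 2 ℂ H H + B ∘L WithLp.sndL 2 ℂ H H).prod
      (C ∘L WithLp.fstL 2 ℂ H H + D ∘L WithLp.sndL 2 ℂ H H))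

/-- `S` is `m`-isometric (for `m ≥ 1`): `∑_{j=0}^m (-1)^j (m choose j) S^{*j} S^j = 0`. -/
def IsMIsometric {K : Type*} [NormedAddCommGroup K] [InnerProductSpace ℂ K] [CompleteSpace K]
    (m : ℕ) (S : K →L[ℂ] K) : Prop :=
  ∑ j ∈ Finset.range (m + 1),
    ((-1 : ℂ) ^ j * (m.choose j : ℂ)) • ((ContinuousLinearMap.adjoint S) ^ j * S ^ j) = 0

/-- For a closed subspace `M` of `K`, the operator `S` on `K` is a lifting of the operator `T`
on `M` if `T P_M = P_M S`. -/
def IsLifting {K : Type*} [NormedAddCommGroup K] [InnerProductSpace ℂ K]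
    (M : Submodule ℂ K) [M.HasOrthogonalProjection] (T : M →L[ℂ] M) (S : K →L[ℂ] K) : Prop :=
  T ∘L M.orthogonalProjectionOnto = M.orthogonalProjectionOnto ∘L S

/-- `T` on `H` has an `m`-isometric lifting: there is a Hilbert space `K` containing `H` as a
closed subspace (that is, `H` is identified through a surjective linear isometry `U` with a
closed subspace `M` of `K`), and an `m`-isometric operator `S` on `K` which is a lifting of `T`
(transported to `M`). The space `K` is required to live in the same universe as `H`. -/
def HasMIsometricLifting.{u} {H : Type u} [NormedAddCommGroup H] [InnerProductSpace ℂ H]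
    (m : ℕ) (T : H →L[ℂ] H) : Prop :=
  ∃ (K : Type u) (_ : NormedAddCommGroup K) (_ : InnerProductSpace ℂ K) (_ : CompleteSpace K)
    (M : Submodule ℂ K) (_ : M.HasOrthogonalProjection) (U : H ≃ₗᵢ[ℂ] M) (S : K →L[ℂ] K),
    IsMIsometric m S ∧
    IsLifting M (U.toContinuousLinearEquiv.toContinuousLinearMap ∘L T ∘L
      U.symm.toContinuousLinearEquiv.toContinuousLinearMap) S

end

/-! Commutant lifting gives an isometry `V` lifting `T` and a bounded `D` lifting `C` with `D V = V
D`. Then `[[V, D], [0, V]]` lifts the given block operator, and its `n`-th power sends `(a, b)` to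
`(Vⁿ a + n Vⁿ⁻¹ D b, Vⁿ b)`. Inner products of such vectors are quadratic in `n`, so their third
difference vanishes. The commuting lift is explicit: `V` is the Schäffer isometry on `ℓ²(ℕ, H)`, and
`D` is the input-output map of a linear system whose transition contraction `W` sends `(D_T h, D_C T
h)` to `(D_T C h, D_C h)`, where `D_T`, `D_C` are defect operators. -/

open scoped InnerProductSpace

/-! ### Contractions and defect operators -/

section PartialIsometry

variable {G F : Type*} [NormedAddCommGroup G] [NormedSpace ℂ G]
  [NormedAddCommGroup F] [InnerProductSpace ℂ F] [CompleteSpace F]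

/-- If `‖A g‖ = ‖B g‖` for all `g`, then `A g ↦ B g` extends to a contraction. -/
theorem exists_contraction_comp_eq (A B : G →L[ℂ] F) (h : ∀ g, ‖A g‖ = ‖B g‖) :
    ∃ W : F →L[ℂ] F, (∀ x, ‖W x‖ ≤ ‖x‖) ∧ ∀ g, W (A g) = B g := by
  let M : Submodule ℂ F := A.range.topologicalClosure
  have hM : IsClosed (M : Set F) := Submodule.isClosed_topologicalClosure _
  have : CompleteSpace M := hM.completeSpace_coe
  have hmem : ∀ g, A g ∈ M := fun g => Submodule.le_topologicalClosure _ ⟨g, rfl⟩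
  let e : G →ₗ[ℂ] M := A.toLinearMap.codRestrict M hmem
  have hdense : DenseRange e := by
    intro y
    rw [closure_subtype]
    have : (Subtype.val '' Set.range e : Set F) = (A.range : Set F) := by
      ext z
      simp [e]
    rw [this]
    exact y.2
  have hnorm : ∀ g, ‖B.toLinearMap g‖ ≤ 1 * ‖e g‖ := by
    intro g
    rw [one_mul]
    exact (h g).ge
  -- Extend by continuity to the closure of the range of `A`, and by zero on its orthogonal
  -- complement.
  refine ⟨(B.toLinearMap.extendOfNorm e) ∘L M.orthogonalProjectionOnto, fun x => ?_, fun g => ?_⟩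
  · refine (LinearMap.norm_extendOfNorm_apply_le hdense 1 hnorm _).trans ?_
    rw [one_mul]
    exact M.norm_orthogonalProjectionOnto_apply_le x
  · have : M.orthogonalProjectionOnto (A g) = e g :=
      M.orthogonalProjectionOnto_mem_subspace_eq_self (e g)
    rw [ContinuousLinearMap.comp_apply, this]
    exact LinearMap.extendOfNorm_eq hdense ⟨1, hnorm⟩ g

end PartialIsometry

section Defect

variable {H : Type*} [NormedAddCommGroup H] [InnerProductSpace ℂ H] [CompleteSpace H]

theorem exists_defect (T : H →L[ℂ] H) (hT : ‖T‖ ≤ 1) :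
    ∃ D : H →L[ℂ] H, ∀ x, ‖T x‖ ^ 2 + ‖D x‖ ^ 2 = ‖x‖ ^ 2 := by
  have key : ∀ x, (⟪(1 - ContinuousLinearMap.adjoint T * T) x, x⟫_ℂ) = (‖x‖ ^ 2 - ‖T x‖ ^ 2 : ℝ) := by
    intro x
    simp [ContinuousLinearMap.adjoint_inner_left, inner_self_eq_norm_sq_to_K]
  have hpos : (0 : H →L[ℂ] H) ≤ 1 - ContinuousLinearMap.adjoint T * T := by
    rw [ContinuousLinearMap.nonneg_iff_isPositive, ContinuousLinearMap.isPositive_iff_complex]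
    intro x
    have h0 := key x
    rw [h0]
    refine ⟨by rw [RCLike.re_to_complex, Complex.ofReal_re], ?_⟩
    have h1 : ‖T x‖ ≤ ‖x‖ := by simpa using T.le_of_opNorm_le hT x
    have := pow_le_pow_left₀ (norm_nonneg _) h1 2
    rw [RCLike.re_to_complex, Complex.ofReal_re]
    linarith
  refine ⟨CFC.sqrt (1 - ContinuousLinearMap.adjoint T * T), fun x => ?_⟩
  set D := CFC.sqrt (1 - ContinuousLinearMap.adjoint T * T) with hD
  have hsa : ContinuousLinearMap.adjoint D = D :=
    (IsSelfAdjoint.of_nonneg (CFC.sqrt_nonneg _)).star_eq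
  have hsq : D * D = 1 - ContinuousLinearMap.adjoint T * T := CFC.sqrt_mul_sqrt_self _ hpos
  have h2 : ⟪D x, D x⟫_ℂ = (‖x‖ ^ 2 - ‖T x‖ ^ 2 : ℝ) := by
    rw [← key, ← hsq, mul_apply_eq_comp, ← ContinuousLinearMap.adjoint_inner_left, hsa]
  have h3 := inner_self_eq_norm_sq (𝕜 := ℂ) (D x)
  rw [h2, RCLike.re_to_complex, Complex.ofReal_re] at h3
  linarith

end Defect

/-! ### Square-summable sequences and linear systems -/

section Sequence

theorem lp_two_hasSum_norm_sq {H : Type*} [NormedAddCommGroup H]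
    (x : lp (fun _ : ℕ => H) 2) :
    HasSum (fun n => ‖x n‖ ^ 2) (‖x‖ ^ 2) := by
  simpa using lp.hasSum_norm (p := 2) (by simp) x

variable {H : Type*} [NormedAddCommGroup H] [InnerProductSpace ℂ H]

/-- A linear map on sequences which is a contraction on every truncation induces a contraction
on square-summable sequences. -/
theorem exists_lp_operator (L : (ℕ → H) →ₗ[ℂ] (ℕ → H))
    (hL : ∀ x N, ∑ n ∈ Finset.range N, ‖L x n‖ ^ 2 ≤ ∑ n ∈ Finset.range N, ‖x n‖ ^ 2) :
    ∃ A : lp (fun _ : ℕ => H) 2 →L[ℂ] lp (fun _ : ℕ => H) 2, ∀ x n, A x n = L x n := by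
  have hbound : ∀ (x : lp (fun _ : ℕ => H) 2) N,
      ∑ n ∈ Finset.range N, ‖L x n‖ ^ 2 ≤ ‖x‖ ^ 2 := fun x N =>
    (hL x N).trans (sum_le_hasSum _ (fun _ _ => sq_nonneg _) (lp_two_hasSum_norm_sq x))
  have hmem : ∀ x : lp (fun _ : ℕ => H) 2, Memℓp (L x) 2 := fun x => by
    refine memℓp_gen ?_
    simpa using summable_of_sum_range_le (fun n => sq_nonneg ‖L x n‖) (hbound x)
  let A : lp (fun _ : ℕ => H) 2 →ₗ[ℂ] lp (fun _ : ℕ => H) 2 :=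
    { toFun := fun x => ⟨L x, hmem x⟩
      map_add' := fun x y => by
        ext n
        exact congrFun (L.map_add (x : ℕ → H) (y : ℕ → H)) n
      map_smul' := fun c x => by
        ext n
        exact congrFun (L.map_smul c (x : ℕ → H)) n }
  refine ⟨A.mkContinuous 1 fun x => ?_, fun x n => rfl⟩
  rw [one_mul]
  refine le_of_sq_le_sq ?_ (norm_nonneg x)
  exact le_of_tendsto (lp_two_hasSum_norm_sq (A x)).tendsto_sum_nat (.of_forall (hbound x))

/-- The Schäffer construction on sequences. -/
def schafferMap (T D : H →L[ℂ] H) : (ℕ → H) →ₗ[ℂ] (ℕ → H) where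
  toFun x
    | 0 => T (x 0)
    | 1 => D (x 0)
    | n + 2 => x (n + 1)
  map_add' x y := by
    funext n
    match n with
    | 0 => simp
    | 1 => simp
    | n + 2 => simp
  map_smul' c x := by
    funext n
    match n with
    | 0 => simp
    | 1 => simp
    | n + 2 => simp

theorem sum_schafferMap {T D : H →L[ℂ] H} (h : ∀ x, ‖T x‖ ^ 2 + ‖D x‖ ^ 2 = ‖x‖ ^ 2)
    (x : ℕ → H) (N : ℕ) :
    ∑ n ∈ Finset.range (N + 2), ‖schafferMap T D x n‖ ^ 2 =
      ∑ n ∈ Finset.range (N + 1), ‖x n‖ ^ 2 := by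
  rw [Finset.sum_range_succ', Finset.sum_range_succ', Finset.sum_range_succ' _ N, ← h (x 0)]
  simp only [schafferMap, LinearMap.coe_mk, AddHom.coe_mk]
  ring

/-- The internal states of the linear system with transition operator `W`, started at `s` and
driven by the input `u`. -/
def systemState (W : WithLp 2 (H × H) →L[ℂ] WithLp 2 (H × H)) (s : H) (u : ℕ → H) : ℕ → H
  | 0 => s
  | n + 1 => (W (WithLp.toLp 2 (u n, systemState W s u n))).snd

/-- The output of the linear system with transition operator `W`, started at `s` and
driven by the input `u`. -/
def systemOutput (W : WithLp 2 (H × H) →L[ℂ] WithLp 2 (H × H)) (s : H) (u : ℕ → H) (n : ℕ) : H :=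
  (W (WithLp.toLp 2 (u n, systemState W s u n))).fst

variable {W : WithLp 2 (H × H) →L[ℂ] WithLp 2 (H × H)}

theorem systemState_add (s t : H) (u v : ℕ → H) (n : ℕ) :
    systemState W (s + t) (u + v) n = systemState W s u n + systemState W t v n := by
  induction n with
  | zero => rfl
  | succ n ih =>
    simp only [systemState, ih, Pi.add_apply, ← WithLp.add_snd, ← map_add, ← WithLp.toLp_add,
      Prod.mk_add_mk]

theorem systemState_smul (c : ℂ) (s : H) (u : ℕ → H) (n : ℕ) :
    systemState W (c • s) (c • u) n = c • systemState W s u n := by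
  induction n with
  | zero => rfl
  | succ n ih =>
    simp only [systemState, ih, Pi.smul_apply, ← WithLp.smul_snd, ← map_smul, ← WithLp.toLp_smul,
      Prod.smul_mk]

theorem systemOutput_add (s t : H) (u v : ℕ → H) (n : ℕ) :
    systemOutput W (s + t) (u + v) n = systemOutput W s u n + systemOutput W t v n := by
  simp only [systemOutput, systemState_add, Pi.add_apply, ← WithLp.add_fst, ← map_add,
    ← WithLp.toLp_add, Prod.mk_add_mk]

theorem systemOutput_smul (c : ℂ) (s : H) (u : ℕ → H) (n : ℕ) :
    systemOutput W (c • s) (c • u) n = c • systemOutput W s u n := by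
  simp only [systemOutput, systemState_smul, Pi.smul_apply, ← WithLp.smul_fst, ← map_smul,
    ← WithLp.toLp_smul, Prod.smul_mk]

theorem systemState_succ (s : H) (u : ℕ → H) (n : ℕ) :
    systemState W s u (n + 1) = systemState W (systemState W s u 1) (fun k => u (k + 1)) n := by
  induction n with
  | zero => rfl
  | succ n ih =>
    change (W (WithLp.toLp 2 (u (n + 1), systemState W s u (n + 1)))).snd = _
    rw [ih]
    rfl

theorem systemOutput_succ (s : H) (u : ℕ → H) (n : ℕ) :
    systemOutput W s u (n + 1) = systemOutput W (systemState W s u 1) (fun k => u (k + 1)) n := by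
  rw [systemOutput, systemState_succ, systemOutput]

/-- Energy balance: each step dissipates since `W` is a contraction, and the retained final state
lets the estimates telescope. -/
theorem sum_systemOutput_le (hW : ∀ x, ‖W x‖ ≤ ‖x‖) (s : H) (u : ℕ → H) (N : ℕ) :
    ∑ n ∈ Finset.range N, ‖systemOutput W s u n‖ ^ 2 + ‖systemState W s u N‖ ^ 2 ≤
      ‖s‖ ^ 2 + ∑ n ∈ Finset.range N, ‖u n‖ ^ 2 := by
  induction N with
  | zero => simp [systemState]
  | succ N ih =>
    have h := pow_le_pow_left₀ (norm_nonneg _)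
      (hW (WithLp.toLp 2 (u N, systemState W s u N))) 2
    rw [WithLp.prod_norm_sq_eq_of_L2, WithLp.prod_norm_sq_eq_of_L2] at h
    change _ ≤ ‖u N‖ ^ 2 + ‖systemState W s u N‖ ^ 2 at h
    rw [Finset.sum_range_succ, Finset.sum_range_succ]
    simp only [systemOutput, systemState] at ih h ⊢
    linarith

/-- The map `x ↦ (C x₀, y)`, where `y` is the output of the system `W` started at `D x₀` with
input `(x₁, x₂, …)`. -/
def systemMap (W : WithLp 2 (H × H) →L[ℂ] WithLp 2 (H × H)) (C D : H →L[ℂ] H) :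
    (ℕ → H) →ₗ[ℂ] (ℕ → H) where
  toFun x
    | 0 => C (x 0)
    | n + 1 => systemOutput W (D (x 0)) (fun k => x (k + 1)) n
  map_add' x y := by
    funext n
    match n with
    | 0 => simp
    | n + 1 =>
      simp only [Pi.add_apply, map_add]
      exact systemOutput_add _ _ (fun k => x (k + 1)) (fun k => y (k + 1)) n
  map_smul' c x := by
    funext n
    match n with
    | 0 => simp
    | n + 1 =>
      simp only [Pi.smul_apply, map_smul]
      exact systemOutput_smul _ _ (fun k => x (k + 1)) n

end Sequence

/-! ### Commutant lifting -/

section Lifting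

variable {H : Type*} [NormedAddCommGroup H] [InnerProductSpace ℂ H] [CompleteSpace H]

/-- Commutant lifting for a pair of commuting contractions, on the space `ℓ²(ℕ, H)` whose
zeroth coordinate is the original space. -/
theorem exists_commuting_lifting_of_contraction (T C : H →L[ℂ] H) (hT : ‖T‖ ≤ 1) (hC : ‖C‖ ≤ 1)
    (hCT : Commute C T) :
    ∃ V D : lp (fun _ : ℕ => H) 2 →L[ℂ] lp (fun _ : ℕ => H) 2,
      (∀ x, ‖V x‖ = ‖x‖) ∧ Commute D V ∧ (∀ x, V x 0 = T (x 0)) ∧ ∀ x, D x 0 = C (x 0) := by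
  obtain ⟨DT, hDT⟩ := exists_defect T hT
  obtain ⟨DC, hDC⟩ := exists_defect C hC
  have hcomm : ∀ h, C (T h) = T (C h) := fun h => DFunLike.congr_fun hCT.eq h
  let e := (WithLp.prodContinuousLinearEquiv 2 ℂ H H).symm.toContinuousLinearMap
  obtain ⟨W, hW, hWeq⟩ := exists_contraction_comp_eq
    (e ∘L (DT.prod (DC ∘L T))) (e ∘L ((DT ∘L C).prod DC)) (fun h => by
      -- Both squared norms equal `‖h‖² - ‖C T h‖²`, because `C T = T C`.
      rw [← sq_eq_sq₀ (norm_nonneg _) (norm_nonneg _), WithLp.prod_norm_sq_eq_of_L2,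
        WithLp.prod_norm_sq_eq_of_L2]
      change ‖DT h‖ ^ 2 + ‖DC (T h)‖ ^ 2 = ‖DT (C h)‖ ^ 2 + ‖DC h‖ ^ 2
      have h1 := hDT h
      have h2 := hDC (T h)
      have h3 := hDT (C h)
      have h4 := hDC h
      rw [hcomm] at h2
      linarith)
  replace hWeq : ∀ h, W (WithLp.toLp 2 (DT h, DC (T h))) = WithLp.toLp 2 (DT (C h), DC h) := hWeq
  obtain ⟨V, hV⟩ := exists_lp_operator (schafferMap T DT) (fun x N => by
    match N with
    | 0 => simp
    | 1 =>
      have := hDT (x 0)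
      have := sq_nonneg ‖DT (x 0)‖
      simp only [Finset.range_one, Finset.sum_singleton, schafferMap, LinearMap.coe_mk,
        AddHom.coe_mk]
      linarith
    | N + 2 =>
      rw [sum_schafferMap hDT, Finset.sum_range_succ _ (N + 1)]
      exact le_add_of_nonneg_right (sq_nonneg _))
  obtain ⟨D, hD⟩ := exists_lp_operator (systemMap W C DC) (fun x N => by
    match N with
    | 0 => simp
    | N + 1 =>
      rw [Finset.sum_range_succ', Finset.sum_range_succ' (fun n => ‖x n‖ ^ 2), ← hDC (x 0)]
      have := sum_systemOutput_le hW (DC (x 0)) (fun k => x (k + 1)) N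
      have := sq_nonneg ‖systemState W (DC (x 0)) (fun k => x (k + 1)) N‖
      simp only [systemMap, LinearMap.coe_mk, AddHom.coe_mk]
      linarith)
  refine ⟨V, D, fun x => ?_, ?_, fun x => hV x 0, fun x => hD x 0⟩
  · rw [← sq_eq_sq₀ (norm_nonneg _) (norm_nonneg _)]
    -- The shifts differ by one because `V` spreads `x 0` over two coordinates.
    have h1 := (Filter.tendsto_add_atTop_iff_nat 2).2 (lp_two_hasSum_norm_sq (V x)).tendsto_sum_nat
    have h2 := (Filter.tendsto_add_atTop_iff_nat 1).2 (lp_two_hasSum_norm_sq x).tendsto_sum_nat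
    simp only [hV, sum_schafferMap hDT] at h1
    exact tendsto_nhds_unique h1 h2
  · ext x n
    change D (V x) n = V (D x) n
    rw [hD, hV]
    have hu : (V x : ℕ → H) = schafferMap T DT x := funext (hV x)
    have hv : (D x : ℕ → H) = systemMap W C DC x := funext (hD x)
    rw [hu, hv]
    match n with
    | 0 => exact hcomm _
    | 1 =>
      change (W (WithLp.toLp 2 (DT (x 0), DC (T (x 0))))).fst = DT (C (x 0))
      rw [hWeq, WithLp.toLp_fst]
    | n + 2 =>
      change systemOutput W (DC (T (x 0))) (fun k => schafferMap T DT x (k + 1)) (n + 1) =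
        systemOutput W (DC (x 0)) (fun k => x (k + 1)) n
      -- Feeding in `DT (x 0)` turns the state `DC (T (x 0))` into `DC (x 0)`; from then on both
      -- systems have the same state and inputs.
      have : systemState W (DC (T (x 0))) (fun k => schafferMap T DT x (k + 1)) 1 = DC (x 0) := by
        change (W (WithLp.toLp 2 (DT (x 0), DC (T (x 0))))).snd = _
        rw [hWeq, WithLp.toLp_snd]
      rw [systemOutput_succ, this]
      rfl

theorem exists_commuting_lifting (T C : H →L[ℂ] H) (hT : ‖T‖ ≤ 1) (hCT : Commute C T) :
    ∃ V D : lp (fun _ : ℕ => H) 2 →L[ℂ] lp (fun _ : ℕ => H) 2,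
      (∀ x, ‖V x‖ = ‖x‖) ∧ Commute D V ∧ (∀ x, V x 0 = T (x 0)) ∧ ∀ x, D x 0 = C (x 0) := by
  -- Commutation and lifting are linear in `C`, so `C` may be rescaled to a contraction; the `+ 1`
  -- covers `C = 0`.
  have hc : 0 < ‖C‖ + 1 := by positivity
  set c : ℂ := ((‖C‖ + 1 : ℝ) : ℂ) with hcdef
  have hc0 : c ≠ 0 := Complex.ofReal_ne_zero.2 hc.ne'
  obtain ⟨V, D, hV, hDV, hVT, hDC⟩ := exists_commuting_lifting_of_contraction T (c⁻¹ • C) hT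
    (by
      rw [norm_smul, norm_inv, hcdef, Complex.norm_real, Real.norm_of_nonneg hc.le,
        inv_mul_le_iff₀ hc]
      linarith)
    (hCT.smul_left _)
  refine ⟨V, c • D, hV, hDV.smul_left _, hVT, fun x => ?_⟩
  simp [hDC, smul_smul, hc0]

end Lifting

/-! ### Three-isometric block operators -/

section Block

variable {K : Type*} [NormedAddCommGroup K] [InnerProductSpace ℂ K]

theorem blockOperator_apply (A B C D : K →L[ℂ] K) (x : WithLp 2 (K × K)) :
    blockOperator A B C D x = WithLp.toLp 2 (A x.fst + B x.snd, C x.fst + D x.snd) :=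
  rfl

/-- An isometry plus a commuting nilpotent of order two is `3`-isometric. -/
theorem isMIsometric_three_blockOperator [CompleteSpace K] {V D : K →L[ℂ] K}
    (hV : ∀ x, ‖V x‖ = ‖x‖) (hDV : Commute D V) :
    IsMIsometric 3 (blockOperator V D 0 V) := by
  have hin : ∀ x y, ⟪V x, V y⟫_ℂ = ⟪x, y⟫_ℂ :=
    fun x y => LinearIsometry.inner_map_map ⟨V.toLinearMap, hV⟩ x y
  have hcomm : ∀ x, D (V x) = V (D x) := fun x => DFunLike.congr_fun hDV.eq x
  have hS : ∀ a b, blockOperator V D 0 V (WithLp.toLp 2 (a, b)) =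
      WithLp.toLp 2 (V a + D b, V b) := fun a b => by simp [blockOperator_apply]
  generalize blockOperator V D 0 V = S at hS
  have hpow : ∀ j x y, ⟪(ContinuousLinearMap.adjoint S ^ j * S ^ j) x, y⟫_ℂ =
      ⟪(S ^ j) x, (S ^ j) y⟫_ℂ := fun j x y => by
    rw [← ContinuousLinearMap.star_eq_adjoint, ← star_pow, ContinuousLinearMap.star_eq_adjoint,
      mul_apply_eq_comp, ContinuousLinearMap.adjoint_inner_left]
  refine ContinuousLinearMap.ext fun x => ext_inner_right ℂ fun y => ?_
  obtain ⟨a, b⟩ := x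
  obtain ⟨c, d⟩ := y
  simp only [Finset.sum_range_succ, Finset.range_zero, Finset.sum_empty, zero_add,
    add_apply, smul_apply, inner_add_left,
    inner_smul_left, hpow]
  simp only [pow_succ, pow_zero, one_mul, mul_apply_eq_comp, one_apply_eq_self, hS,
    WithLp.prod_inner_apply, map_add, hcomm, hin, inner_add_left, inner_add_right,
    zero_apply, inner_zero_left, Nat.choose]
  simp [map_ofNat (starRingEnd ℂ) 3]
  ring

end Block

/-! ### Embedding the direct sum and testing liftings -/

section Diag

variable {E K : Type*} [NormedAddCommGroup E] [InnerProductSpace ℂ E]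
  [NormedAddCommGroup K] [InnerProductSpace ℂ K]

/-- The isometry `J ⊕ J`. -/
def diagIsometry (J : E →ₗᵢ[ℂ] K) : WithLp 2 (E × E) →ₗᵢ[ℂ] WithLp 2 (K × K) where
  toFun h := WithLp.toLp 2 (J h.fst, J h.snd)
  map_add' x y := by
    rw [WithLp.add_fst, WithLp.add_snd, J.map_add, J.map_add]
    rfl
  map_smul' c x := by
    rw [WithLp.smul_fst, WithLp.smul_snd, J.map_smul, J.map_smul]
    rfl
  norm_map' x := by
    rw [← sq_eq_sq₀ (norm_nonneg _) (norm_nonneg _), WithLp.prod_norm_sq_eq_of_L2,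
      WithLp.prod_norm_sq_eq_of_L2]
    change ‖J x.fst‖ ^ 2 + ‖J x.snd‖ ^ 2 = _
    rw [J.norm_map, J.norm_map]

end Diag

section Range

variable {E K : Type*} [NormedAddCommGroup E] [InnerProductSpace ℂ E]
  [NormedAddCommGroup K] [InnerProductSpace ℂ K]

/-- A lifting may be tested on any isometric embedding `J` with adjoint `R`. -/
theorem exists_isLifting_of_linearIsometry (J : E →ₗᵢ[ℂ] K) (R : K → E)
    (hR : ∀ h x, ⟪J h, x⟫_ℂ = ⟪h, R x⟫_ℂ) {T : E →L[ℂ] E} {S : K →L[ℂ] K}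
    (hTS : ∀ x, R (S x) = T (R x)) :
    ∃ (M : Submodule ℂ K) (_ : M.HasOrthogonalProjection) (U : E ≃ₗᵢ[ℂ] M),
      IsLifting M (U.toContinuousLinearEquiv.toContinuousLinearMap ∘L T ∘L
        U.symm.toContinuousLinearEquiv.toContinuousLinearMap) S := by
  let M : Submodule ℂ K := J.toLinearMap.range
  -- This makes `J ∘ R` the orthogonal projection onto the range of `J`.
  have hperp : ∀ x, x - J (R x) ∈ Mᗮ := by
    intro x
    rw [Submodule.mem_orthogonal]
    rintro _ ⟨h, rfl⟩
    change ⟪J h, x - J (R x)⟫_ℂ = 0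
    rw [inner_sub_right, hR, J.inner_map_map, sub_self]
  have hM : M.HasOrthogonalProjection := ⟨fun x => ⟨J (R x), ⟨R x, rfl⟩, hperp x⟩⟩
  let U : E ≃ₗᵢ[ℂ] M := J.equivRange
  have hproj : ∀ x, M.orthogonalProjectionOnto x = U (R x) := fun x =>
    Subtype.ext (Submodule.eq_starProjection_of_mem_orthogonal ⟨R x, rfl⟩ (hperp x))
  refine ⟨M, hM, U, ContinuousLinearMap.ext fun x => ?_⟩
  change U (T (U.symm (M.orthogonalProjectionOnto x))) = M.orthogonalProjectionOnto (S x)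
  rw [hproj, hproj, U.symm_apply_apply, hTS]

end Range

theorem corollary4p3 {H : Type*} [NormedAddCommGroup H] [InnerProductSpace ℂ H] [CompleteSpace H]
    (T C : H →L[ℂ] H) (hT : ‖T‖ ≤ 1) (hC : Commute C T) :
    HasMIsometricLifting 3 (blockOperator T C 0 T) := by
  obtain ⟨V, D, hV, hDV, hVT, hDC⟩ := exists_commuting_lifting T C hT hC
  let L := lp (fun _ : ℕ => H) 2
  let ι : H →ₗᵢ[ℂ] L :=
    ⟨lp.lsingle (E := fun _ : ℕ => H) 2 0, lp.norm_single (E := fun _ : ℕ => H) (by norm_num) 0⟩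
  have hι : ∀ h (x : L), ⟪ι h, x⟫_ℂ = ⟪h, x 0⟫_ℂ := fun h x => lp.inner_single_left 0 h x
  obtain ⟨M, hM, U, hU⟩ := exists_isLifting_of_linearIsometry (diagIsometry ι)
    (fun x => WithLp.toLp 2 (x.fst 0, x.snd 0)) (T := blockOperator T C 0 T)
    (S := blockOperator V D 0 V)
    (fun h x => by
      rw [WithLp.prod_inner_apply, WithLp.prod_inner_apply]
      exact congrArg₂ _ (hι h.fst x.fst) (hι h.snd x.snd))
    (fun x => by
      simp [blockOperator_apply, hVT, hDC])
  exact ⟨WithLp 2 (L × L), inferInstance, inferInstance, inferInstance, M, hM, U,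
    blockOperator V D 0 V, isMIsometric_three_blockOperator hV hDV, hU⟩
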